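/- Let $n,\ell,m\ge 0$ be integers. For a partition $\lambda$ of $n$, let its $2$-measure be the maximal length of a subsequence of the sequence of parts of $\lambda$ (listed with multiplicity, in weakly decreasing order) in which any two consecutive terms differ by at least $2$, and let its Durfee square be the largest square contained in the Ferrers diagram of $\lambda$ and sharing its top-left corner. Then the number of partitions of $n$ with exactly $\ell$ parts and $2$-measure equal to $m$ equals the number of partitions of $n$ with exactly $\ell$ parts and Durfee square of side length $m$. -/

import Mathlib

/-- The parts of a partition, listed with multiplicity in weakly decreasing order. -/
def Nat.Partition.partsList {n : ℕ} (p : n.Partition) : List ℕ :=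
  p.parts.sort (· ≥ ·)

/-- The `k`-measure of a partition: the length of a longest subsequence of its parts (listed in
weakly decreasing order) in which any two consecutive terms differ by at least `k`. -/
def Nat.Partition.kMeasure (k : ℕ) {n : ℕ} (p : n.Partition) : ℕ :=
  (p.partsList.sublists.toFinset.filter
    fun s => s.IsChain fun a b => b + k ≤ a).sup List.length

/-- The Ferrers diagram of a partition: its `i`-th row has as many cells as the `i`-th largest
part. -/
def Nat.Partition.ferrers {n : ℕ} (p : n.Partition) : YoungDiagram :=
  YoungDiagram.ofRowLens p.partsList (p.parts.pairwise_sort (· ≥ ·)).sortedGE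

/-- The side length of the Durfee square: the largest `d` such that the `d × d` square anchored at
the top left corner lies in the Ferrers diagram.
Such a `d` satisfies `d ≤ d ^ 2 ≤ n`, so the search may be bounded by `n`. -/
def Nat.Partition.durfee {n : ℕ} (p : n.Partition) : ℕ :=
  Nat.findGreatest (fun d => Finset.range d ×ˢ Finset.range d ⊆ p.ferrers.cells) n

open Finset PowerSeries

namespace PartitionSeries

/-! Let z mark the number of parts and q their sum; `rescale X` is z ↦ zq and adds 1 to every part.
For either statistic, let F_m(z) be the series of partitions with value m. Both families satisfy
F_{m+1}(z) = F_{m+1}(zq) + K(z) F_m(zq²), where K(z) = zq/((1-zq)(1-zq²)), and F_0 = 1. By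
`genFun_eq_durfeeSet` this recursion has only one solution with no constant term in z for positive
index. For the 2-measure (`genFun_measureSet_succ`), the first term counts partitions without a part
1. In the others, the parts 1 and 2 contribute exactly 1 to the measure and the parts at least 3 are
free. For the Durfee square (`genFun_durfeeSet_succ`), the recursion is read off the closed form z^m
q^{m²} / ∏_{i=1}^m (1-q^i)(1-zq^i). -/

/-! ### Bivariate generating functions -/

open Classical in
/-- The multisets of positive integers in `S` with `l` elements and sum `n`. -/
noncomputable def slice (S : Set (Multiset ℕ)) (l n : ℕ) : Finset (Multiset ℕ) :=
  ((univ : Finset n.Partition).image Nat.Partition.parts).filter fun s => s ∈ S ∧ s.card = l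

lemma mem_slice {S : Set (Multiset ℕ)} {l n : ℕ} {s : Multiset ℕ} :
    s ∈ slice S l n ↔ 0 ∉ s ∧ s.sum = n ∧ s ∈ S ∧ s.card = l := by
  classical
  simp only [slice, mem_filter, mem_image, mem_univ, true_and]
  constructor
  · rintro ⟨⟨p, rfl⟩, h⟩
    exact ⟨fun h0 => (p.parts_pos h0).ne rfl, p.parts_sum, h⟩
  · rintro ⟨h0, hn, h⟩
    exact ⟨⟨⟨s, fun {i} hi => Nat.pos_of_ne_zero fun h => h0 (h ▸ hi), hn⟩, rfl⟩, h⟩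

lemma card_slice (S : Set (Multiset ℕ)) (l n : ℕ) [DecidablePred fun p : n.Partition =>
    p.parts.card = l ∧ p.parts ∈ S] :
    #(univ.filter fun p : n.Partition => p.parts.card = l ∧ p.parts ∈ S) = #(slice S l n) := by
  classical
  refine card_bij (fun p _ => p.parts) ?_ (fun p _ q _ h => Nat.Partition.ext h) ?_
  · intro p hp
    simp only [mem_filter, mem_univ, true_and] at hp
    exact mem_slice.2 ⟨fun h0 => (p.parts_pos h0).ne rfl, p.parts_sum, hp.2, hp.1⟩
  · intro s hs
    obtain ⟨h0, hn, h, hl⟩ := mem_slice.1 hs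
    exact ⟨⟨s, fun {i} hi => Nat.pos_of_ne_zero fun h => h0 (h ▸ hi), hn⟩, by simp [h, hl], rfl⟩

/-- The generating function of the multisets of positive integers in `S`: the outer variable marks
the number of elements, the inner one their sum. -/
noncomputable def genFun (S : Set (Multiset ℕ)) : ℤ⟦X⟧⟦X⟧ :=
  PowerSeries.mk fun l => PowerSeries.mk fun n => (#(slice S l n) : ℤ)

lemma coeff_coeff_genFun (S : Set (Multiset ℕ)) (l n : ℕ) :
    coeff n (coeff l (genFun S)) = #(slice S l n) := by
  simp [genFun]

lemma genFun_congr {S T : Set (Multiset ℕ)} (h : ∀ s, 0 ∉ s → (s ∈ S ↔ s ∈ T)) :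
    genFun S = genFun T := by
  ext l n
  rw [coeff_coeff_genFun, coeff_coeff_genFun]
  congr 2
  ext s
  simp only [mem_slice]
  grind

lemma genFun_disjUnion {S T U : Set (Multiset ℕ)} (h : ∀ s, 0 ∉ s → (s ∈ U ↔ s ∈ S ∨ s ∈ T))
    (hd : ∀ s ∈ S, s ∉ T) : genFun U = genFun S + genFun T := by
  classical
  ext l n
  rw [map_add, map_add, coeff_coeff_genFun, coeff_coeff_genFun, coeff_coeff_genFun]
  norm_cast
  rw [← card_union_of_disjoint]
  · congr 1
    ext s
    simp only [mem_slice, mem_union]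
    grind
  · rw [Finset.disjoint_left]
    intro s
    simp only [mem_slice]
    grind

/-- Size and sum are additive, so unique decomposition becomes a product; `hinj` need only recover
the first summand, by cancellation. -/
lemma genFun_mul {S T U : Set (Multiset ℕ)}
    (h : ∀ u, 0 ∉ u → (u ∈ U ↔ ∃ s ∈ S, ∃ t ∈ T, s + t = u))
    (hinj : ∀ s ∈ S, ∀ t ∈ T, ∀ s' ∈ S, ∀ t' ∈ T, s + t = s' + t' → s = s') :
    genFun U = genFun S * genFun T := by
  classical
  ext l n
  simp only [coeff_mul, map_sum, coeff_coeff_genFun]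
  norm_cast
  simp_rw [← card_product]
  rw [← Finset.sum_product', ← Finset.card_sigma]
  symm
  refine card_bij (fun x _ => x.2.1 + x.2.2) ?_ ?_ ?_
  · rintro ⟨⟨⟨l₁, l₂⟩, n₁, n₂⟩, s, t⟩ hx
    simp only [mem_sigma, mem_product, HasAntidiagonal.mem_antidiagonal, mem_slice] at hx ⊢
    obtain ⟨⟨rfl, rfl⟩, ⟨hs0, rfl, hs, rfl⟩, ht0, rfl, ht, rfl⟩ := hx
    have h0 : 0 ∉ s + t := by simp [hs0, ht0]
    exact ⟨h0, by simp, (h _ h0).2 ⟨s, hs, t, ht, rfl⟩, by simp⟩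
  · rintro ⟨⟨⟨l₁, l₂⟩, n₁, n₂⟩, s, t⟩ hx ⟨⟨⟨l₁', l₂'⟩, n₁', n₂'⟩, s', t'⟩ hx' hst
    simp only [mem_sigma, mem_product, HasAntidiagonal.mem_antidiagonal, mem_slice] at hx hx' hst
    obtain ⟨-, ⟨-, rfl, hs, rfl⟩, -, rfl, ht, rfl⟩ := hx
    obtain ⟨-, ⟨-, rfl, hs', rfl⟩, -, rfl, ht', rfl⟩ := hx'
    obtain rfl := hinj s hs t ht s' hs' t' ht' hst
    obtain rfl := add_left_cancel hst
    rfl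
  · intro u hu
    obtain ⟨h0, rfl, hU, rfl⟩ := mem_slice.1 hu
    obtain ⟨s, hs, t, ht, rfl⟩ := (h _ h0).1 hU
    simp only [Multiset.mem_add, not_or] at h0
    refine ⟨⟨⟨⟨s.card, t.card⟩, s.sum, t.sum⟩, s, t⟩, ?_, rfl⟩
    simp only [mem_sigma, mem_product, HasAntidiagonal.mem_antidiagonal, mem_slice]
    simp [h0, hs, ht]

lemma genFun_singleton {s : Multiset ℕ} (h : 0 ∉ s) :
    genFun {s} = C (X ^ s.sum) * X ^ s.card := by
  ext l n
  rw [coeff_coeff_genFun, coeff_C_mul, coeff_X_pow]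
  have : slice {s} l n = if l = s.card ∧ n = s.sum then {s} else ∅ := by
    ext t
    rw [mem_slice, Set.mem_singleton_iff]
    split_ifs with hc
    · obtain ⟨rfl, rfl⟩ := hc
      rw [mem_singleton]
      constructor
      · exact fun h => h.2.2.1
      · rintro rfl
        exact ⟨h, rfl, rfl, rfl⟩
    · simp only [notMem_empty, iff_false]
      rintro ⟨-, rfl, rfl, rfl⟩
      exact hc ⟨rfl, rfl⟩
  rw [this]
  by_cases hl : l = s.card <;> by_cases hn : n = s.sum <;> simp [hl, hn, coeff_X_pow]

/-- Adding 1 to each of l parts raises the sum by l, which is the substitution z ↦ zq. -/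
lemma genFun_shift {S T : Set (Multiset ℕ)} (h : ∀ s, 0 ∉ s → (s.map (· + 1) ∈ T ↔ s ∈ S))
    (hT : ∀ t ∈ T, 1 ∉ t) : genFun T = rescale X (genFun S) := by
  ext l n
  rw [coeff_rescale, coeff_X_pow_mul', coeff_coeff_genFun, coeff_coeff_genFun]
  have key : ∀ s : Multiset ℕ, 0 ∉ s.map (· + 1) := by simp
  split_ifs with hl
  · norm_cast
    symm
    refine card_bij (fun s _ => s.map (· + 1)) ?_ ?_ ?_
    · intro s hs
      obtain ⟨h0, hn, hS, rfl⟩ := mem_slice.1 hs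
      refine mem_slice.2 ⟨key s, ?_, (h s h0).2 hS, by simp⟩
      rw [Multiset.sum_map_add]
      simp
      omega
    · intro s _ t _ hst
      exact Multiset.map_injective (add_left_injective 1) hst
    · intro t ht
      obtain ⟨h0, hn, htT, rfl⟩ := mem_slice.1 ht
      have e : (t.map (· - 1)).map (· + 1) = t := by
        rw [Multiset.map_map]
        conv_rhs => rw [← Multiset.map_id t]
        refine Multiset.map_congr rfl fun x hx => ?_
        have : x ≠ 0 := fun hx0 => h0 (hx0 ▸ hx)
        simp
        omega
      have h0' : 0 ∉ t.map (· - 1) := by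
        intro hc
        obtain ⟨x, hx, hx1⟩ := Multiset.mem_map.1 hc
        have : x ≠ 0 := fun hx0 => h0 (hx0 ▸ hx)
        have : x ≠ 1 := fun hx0 => hT t htT (hx0 ▸ hx)
        omega
      refine ⟨t.map (· - 1), mem_slice.2 ⟨h0', ?_, (h _ h0').1 (e.symm ▸ htT), by simp⟩, e⟩
      have := congrArg Multiset.sum e
      rw [Multiset.sum_map_add] at this
      simp at this
      omega
  · norm_cast
    rw [card_eq_zero, eq_empty_iff_forall_notMem]
    intro t ht
    obtain ⟨h0, rfl, ht, rfl⟩ := mem_slice.1 ht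
    refine hl ?_
    have := Multiset.card_nsmul_le_sum (s := t) (a := 1) fun x hx =>
      Nat.pos_of_ne_zero fun hx0 => h0 (hx0 ▸ hx)
    simpa using this

lemma genFun_cons {S T : Set (Multiset ℕ)} {a : ℕ} (ha : 0 < a)
    (h : ∀ s, 0 ∉ s → (s ∈ T ↔ ∃ t ∈ S, a ::ₘ t = s)) :
    genFun T = C (X ^ a) * X * genFun S := by
  rw [genFun_mul (S := {{a}}) (T := S) (by simpa using h) (by simp), genFun_singleton] <;>
    simp [ha.ne]

/-! ### Product formulas for bounded parts -/

/-- Partitions into parts at most `m`. -/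
lemma genFun_le_succ (m : ℕ) :
    (1 - C (X ^ (m + 1)) * X) * genFun {s | ∀ x ∈ s, x ≤ m + 1} = genFun {s | ∀ x ∈ s, x ≤ m} := by
  have h := genFun_disjUnion (U := {s | ∀ x ∈ s, x ≤ m + 1}) (S := {s | ∀ x ∈ s, x ≤ m})
    (T := {s | (∀ x ∈ s, x ≤ m + 1) ∧ m + 1 ∈ s}) (by simp only [Set.mem_ofPred_eq]; grind)
    (by simp only [Set.mem_ofPred_eq]; grind)
  rw [genFun_cons (T := {s | (∀ x ∈ s, x ≤ m + 1) ∧ m + 1 ∈ s})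
    (S := {s | ∀ x ∈ s, x ≤ m + 1}) (a := m + 1) (by omega)] at h
  · linear_combination h
  · intro s _
    constructor
    · rintro ⟨h1, h2⟩
      obtain ⟨t, rfl⟩ := Multiset.exists_cons_of_mem h2
      exact ⟨t, fun x hx => h1 x (Multiset.mem_cons_of_mem hx), rfl⟩
    · rintro ⟨t, ht, rfl⟩
      simp only [Set.mem_ofPred_eq] at *
      simpa using ht

lemma genFun_le_zero : genFun {s | ∀ x ∈ s, x ≤ 0} = 1 := by
  rw [genFun_congr (T := {0}), genFun_singleton] <;> simp
  intro s hs
  constructor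
  · intro h
    by_contra hne
    obtain ⟨x, hx⟩ := Multiset.exists_mem_of_ne_zero hne
    exact hs (h x hx ▸ hx)
  · rintro rfl
    simp

lemma prod_mul_genFun_le (m : ℕ) :
    (∏ i ∈ range m, (1 - C (X ^ (i + 1)) * X)) * genFun {s | ∀ x ∈ s, x ≤ m} = 1 := by
  induction m with
  | zero => rw [prod_range_zero, one_mul, genFun_le_zero]
  | succ m ih => rw [prod_range_succ, mul_assoc, genFun_le_succ, ih]

/-- Either `a` occurs and one copy can be removed, or all parts exceed `a` and the shift applies. -/
lemma genFun_card_ge_succ (k a : ℕ) (ha : 0 < a) :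
    C (1 - X ^ (k + 1)) * genFun {s | s.card = k + 1 ∧ ∀ x ∈ s, a ≤ x} =
      C (X ^ a) * X * genFun {s | s.card = k ∧ ∀ x ∈ s, a ≤ x} := by
  have h := genFun_disjUnion (U := {s | s.card = k + 1 ∧ ∀ x ∈ s, a ≤ x})
    (S := {s | s.card = k + 1 ∧ ∀ x ∈ s, a + 1 ≤ x})
    (T := {s | (s.card = k + 1 ∧ ∀ x ∈ s, a ≤ x) ∧ a ∈ s}) (by simp only [Set.mem_ofPred_eq]; grind)
    (by simp only [Set.mem_ofPred_eq]; grind)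
  rw [genFun_cons (T := {s | (s.card = k + 1 ∧ ∀ x ∈ s, a ≤ x) ∧ a ∈ s})
      (S := {s | s.card = k ∧ ∀ x ∈ s, a ≤ x}) (a := a) ha,
    genFun_shift (T := {s | s.card = k + 1 ∧ ∀ x ∈ s, a + 1 ≤ x})
      (S := {s | s.card = k + 1 ∧ ∀ x ∈ s, a ≤ x})] at h
  -- The series is homogeneous of degree k+1 in z, so z ↦ zq multiplies it by q^{k+1}.
  · have h2 : rescale X (genFun {s | s.card = k + 1 ∧ ∀ x ∈ s, a ≤ x}) =
        C (X ^ (k + 1)) * genFun {s | s.card = k + 1 ∧ ∀ x ∈ s, a ≤ x} := by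
      ext1 l
      rw [coeff_rescale, coeff_C_mul]
      by_cases hl : l = k + 1
      · rw [hl]
      · have : coeff l (genFun {s | s.card = k + 1 ∧ ∀ x ∈ s, a ≤ x}) = 0 := by
          ext n
          rw [coeff_coeff_genFun]
          simp only [map_zero, Nat.cast_eq_zero, card_eq_zero, eq_empty_iff_forall_notMem,
            mem_slice, Set.mem_ofPred_eq]
          grind
        simp [this]
    rw [map_sub, map_one]
    linear_combination h + h2
  · intro s _
    simp
  · rintro t ⟨-, ht⟩ h1
    have := ht 1 h1
    omega
  · intro s _
    constructor
    · rintro ⟨⟨hc, h1⟩, h2⟩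
      obtain ⟨t, rfl⟩ := Multiset.exists_cons_of_mem h2
      exact ⟨t, ⟨by simpa using hc, fun x hx => h1 x (Multiset.mem_cons_of_mem hx)⟩, rfl⟩
    · rintro ⟨t, ⟨hc, ht⟩, rfl⟩
      simp only [Set.mem_ofPred_eq] at *
      simpa [hc] using ht

lemma prod_mul_genFun_card_ge (k a : ℕ) (ha : k = 0 ∨ 0 < a) :
    C (∏ i ∈ range k, (1 - X ^ (i + 1))) * genFun {s | s.card = k ∧ ∀ x ∈ s, a ≤ x} =
      C (X ^ (a * k)) * X ^ k := by
  induction k with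
  | zero =>
    rw [genFun_congr (T := {0}), genFun_singleton] <;> simp
    intro s _
    rintro rfl
    simp
  | succ k ih =>
    rw [prod_range_succ, map_mul, mul_assoc, genFun_card_ge_succ k a (by omega), mul_left_comm,
      ih (by omega)]
    simp only [map_pow]
    ring

/-! ### Durfee series: closed form and recursion -/

/-- The multisets that split into `m` elements at least `m` and further elements at most `m`. -/
def durfeeSet (m : ℕ) : Set (Multiset ℕ) :=
  {u | ∃ s : Multiset ℕ, (s.card = m ∧ ∀ x ∈ s, m ≤ x) ∧
    ∃ t : Multiset ℕ, (∀ x ∈ t, x ≤ m) ∧ s + t = u}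

/-- Makes the Durfee splitting unique although parts equal to `m` may lie on either side: the parts
above `m` and the cardinality determine `s`. -/
lemma eq_filter_add_replicate {s : Multiset ℕ} {m : ℕ} (h : ∀ x ∈ s, m ≤ x) :
    s = s.filter (m < ·) + Multiset.replicate (s.card - (s.filter (m < ·)).card) m := by
  have h1 := Multiset.filter_add_not (m < ·) s
  have h2 : s.filter (fun x => ¬ m < x) =
      Multiset.replicate (s.filter fun x => ¬ m < x).card m := by
    refine Multiset.eq_replicate_card.2 fun x hx => ?_
    obtain ⟨hx, hx'⟩ := Multiset.mem_filter.1 hx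
    have := h x hx
    omega
  have h3 := congrArg Multiset.card h1
  rw [Multiset.card_add] at h3
  have h4 : s.card - (s.filter (m < ·)).card = (s.filter fun x => ¬ m < x).card := by omega
  rw [h4, ← h2, h1]

lemma filter_lt_add {s t : Multiset ℕ} {m : ℕ} (ht : ∀ x ∈ t, x ≤ m) :
    (s + t).filter (m < ·) = s.filter (m < ·) := by
  rw [Multiset.filter_add, Multiset.filter_eq_nil (s := t) |>.2, add_zero]
  intro x hx
  exact not_lt.2 (ht x hx)

lemma mul_genFun_durfeeSet (m : ℕ) :
    C (∏ i ∈ range m, (1 - X ^ (i + 1))) * (∏ i ∈ range m, (1 - C (X ^ (i + 1)) * X)) *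
      genFun (durfeeSet m) = C (X ^ (m * m)) * X ^ m := by
  have h : genFun (durfeeSet m) =
      genFun {s | s.card = m ∧ ∀ x ∈ s, m ≤ x} * genFun {s | ∀ x ∈ s, x ≤ m} := by
    refine genFun_mul (fun u _ => Iff.rfl) ?_
    rintro s ⟨hs, hsm⟩ t ht s' ⟨hs', hsm'⟩ t' ht' hst
    rw [eq_filter_add_replicate hsm, eq_filter_add_replicate hsm', hs, hs',
      ← filter_lt_add (s := s) ht, ← filter_lt_add (s := s') ht', hst]
  have h1 := prod_mul_genFun_le m
  have h2 : C (∏ i ∈ range m, (1 - X ^ (i + 1))) * genFun {s | s.card = m ∧ ∀ x ∈ s, m ≤ x} =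
      C (X ^ (m * m)) * X ^ m := prod_mul_genFun_card_ge m m (by omega)
  rw [h]
  linear_combination h2 * (∏ i ∈ range m, (1 - C (X ^ (i + 1)) * X)) *
    genFun {s | ∀ x ∈ s, x ≤ m} + C (X ^ (m * m)) * X ^ m * h1

lemma rescale_X_C (a : ℤ⟦X⟧) : rescale (X : ℤ⟦X⟧) (C a) = C a := by
  ext1 n
  rw [coeff_rescale, coeff_C]
  split_ifs with h <;> simp [h]

lemma one_sub_mul_rescale_prod (m : ℕ) :
    (1 - C (X : ℤ⟦X⟧) * X) *
      rescale (X : ℤ⟦X⟧) (∏ i ∈ range m, (1 - C ((X : ℤ⟦X⟧) ^ (i + 1)) * X)) =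
      ∏ i ∈ range (m + 1), (1 - C ((X : ℤ⟦X⟧) ^ (i + 1)) * X) := by
  rw [prod_range_succ', map_prod, mul_comm]
  congr 1
  · refine prod_congr rfl fun i _ => ?_
    rw [map_sub, map_one, map_mul, rescale_X_C, rescale_X, ← mul_assoc, ← map_mul, ← pow_succ]
  · simp

lemma one_sub_C_mul_X_ne_zero (a : ℤ⟦X⟧) : 1 - C a * X ≠ 0 := by
  intro h
  have := congrArg (coeff 0) h
  simp at this

lemma one_sub_X_pow_ne_zero (k : ℕ) : (1 - X ^ (k + 1) : ℤ⟦X⟧) ≠ 0 := by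
  intro h
  have := congrArg (coeff 0) h
  simp at this

lemma genFun_one_mem_le_two :
    ((1 - C (X : ℤ⟦X⟧) * X) * (1 - C ((X : ℤ⟦X⟧) ^ 2) * X)) *
      genFun {s | (∀ x ∈ s, x ≤ 2) ∧ 1 ∈ s} = C X * X := by
  rw [genFun_cons (a := 1) (S := {s | ∀ x ∈ s, x ≤ 2}) one_pos]
  · have h := prod_mul_genFun_le 2
    simp only [prod_range_succ, prod_range_zero, zero_add, pow_one, one_mul, one_add_one_eq_two]
      at h
    rw [pow_one]
    linear_combination (C X * X) * h
  · intro s _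
    constructor
    · rintro ⟨h1, h2⟩
      obtain ⟨t, rfl⟩ := Multiset.exists_cons_of_mem h2
      exact ⟨t, fun x hx => h1 x (Multiset.mem_cons_of_mem hx), rfl⟩
    · rintro ⟨t, ht, rfl⟩
      simp only [Set.mem_ofPred_eq] at *
      simpa using ht

lemma genFun_durfeeSet_succ (m : ℕ) :
    genFun (durfeeSet (m + 1)) = rescale X (genFun (durfeeSet (m + 1))) +
      genFun {s | (∀ x ∈ s, x ≤ 2) ∧ 1 ∈ s} * rescale X (rescale X (genFun (durfeeSet m))) := by
  set D := genFun (durfeeSet (m + 1))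
  set E := genFun (durfeeSet m)
  set K := genFun {s | (∀ x ∈ s, x ≤ 2) ∧ 1 ∈ s}
  set σ := rescale (X : ℤ⟦X⟧) with hσ
  have hX : σ X = C X * X := rescale_X _
  have hC (a : ℤ⟦X⟧) : σ (C a) = C a := rescale_X_C a
  set N : ℕ → ℤ⟦X⟧ := fun m => ∏ i ∈ range m, (1 - X ^ (i + 1)) with hN
  set Q : ℕ → ℤ⟦X⟧⟦X⟧ := fun m => ∏ i ∈ range m, (1 - C ((X : ℤ⟦X⟧) ^ (i + 1)) * X) with hQ
  have hNs : N (m + 1) = N m * (1 - X ^ (m + 1)) := prod_range_succ _ _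
  have hQs (k : ℕ) : Q (k + 1) = Q k * (1 - C (X ^ (k + 1)) * X) := prod_range_succ _ _
  have hQσ (k : ℕ) : (1 - C X * X) * σ (Q k) = Q (k + 1) := one_sub_mul_rescale_prod k
  have hQσσ : ((1 - C X * X) * (1 - C (X ^ 2) * X)) * σ (σ (Q m)) = Q (m + 2) := by
    have := congrArg σ (hQσ m)
    simp only [map_mul, map_sub, map_one, hX, hC] at this
    rw [← hQσ, ← this, pow_two, map_mul]
    ring
  have hD : C (N (m + 1)) * Q (m + 1) * D = C (X ^ ((m + 1) * (m + 1))) * X ^ (m + 1) :=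
    mul_genFun_durfeeSet (m + 1)
  have hE : C (N m) * Q m * E = C (X ^ (m * m)) * X ^ m := mul_genFun_durfeeSet m
  have hK : ((1 - C X * X) * (1 - C (X ^ 2) * X)) * K = C X * X := genFun_one_mem_le_two
  have hσD := congrArg σ hD
  have hσE := congrArg (fun f => σ (σ f)) hE
  simp only [map_mul, map_pow, hC, hX] at hσD hσE
  have hne : C (N (m + 1)) * Q (m + 2) ≠ 0 := by
    refine mul_ne_zero ?_ (prod_ne_zero_iff.2 fun i _ => one_sub_C_mul_X_ne_zero _)
    rw [Ne, map_eq_zero_iff _ C_injective]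
    exact prod_ne_zero_iff.2 fun i _ => one_sub_X_pow_ne_zero _
  -- Over this common denominator the claim reduces to 1 - zq^{m+2} = (1-zq)q^{m+1} + (1-q^{m+1}).
  refine mul_left_cancel₀ hne ?_
  have e1 : C (N (m + 1)) * Q (m + 2) * D =
      (1 - C (X ^ (m + 2)) * X) * (C (X ^ ((m + 1) * (m + 1))) * X ^ (m + 1)) := by
    rw [← hD, hQs (m + 1)]; ring
  have e2 : C (N (m + 1)) * Q (m + 2) * σ D =
      (1 - C X * X) * (C X ^ ((m + 1) * (m + 1)) * (C X * X) ^ (m + 1)) := by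
    rw [← hσD, ← hQσ (m + 1)]; ring
  have e3 : C (N (m + 1)) * Q (m + 2) * (K * σ (σ E)) =
      (1 - C X ^ (m + 1)) * (C X * X) * (C X ^ (m * m) * (C X * (C X * X)) ^ m) := by
    rw [← hσE, ← hK, ← hQσσ, hNs]
    simp only [map_mul, map_sub, map_one, map_pow]
    ring
  rw [mul_add, e1, e2, e3]
  simp only [map_pow]
  ring

/-! ### Uniqueness of the solution -/

/-- The coefficient of z^l is killed by 1 - q^l, a nonzero factor for l > 0. -/
lemma eq_zero_of_eq_rescale {f : ℤ⟦X⟧⟦X⟧} (h : f = rescale X f) (h0 : coeff 0 f = 0) :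
    f = 0 := by
  ext1 l
  cases l with
  | zero => simpa using h0
  | succ l =>
    have := congrArg (coeff (l + 1)) h
    rw [coeff_rescale] at this
    have h2 : (1 - X ^ (l + 1)) * coeff (l + 1) f = 0 := by linear_combination this
    simpa [one_sub_X_pow_ne_zero] using h2

lemma coeff_zero_genFun {S : Set (Multiset ℕ)} (h : 0 ∉ S) : coeff 0 (genFun S) = 0 := by
  ext n
  rw [coeff_coeff_genFun]
  simp only [map_zero, Nat.cast_eq_zero, card_eq_zero, eq_empty_iff_forall_notMem, mem_slice,
    Multiset.card_eq_zero]
  rintro s ⟨-, -, hs, rfl⟩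
  exact h hs

lemma zero_notMem_durfeeSet (m : ℕ) : 0 ∉ durfeeSet (m + 1) := by
  rintro ⟨s, ⟨hs, -⟩, t, -, h⟩
  obtain ⟨rfl, -⟩ := add_eq_zero.1 h
  simp at hs

lemma genFun_durfeeSet_zero : genFun (durfeeSet 0) = 1 := by
  simpa using mul_genFun_durfeeSet 0

lemma genFun_eq_durfeeSet {M : ℕ → Set (Multiset ℕ)} (h0 : genFun (M 0) = 1)
    (hM : ∀ m, 0 ∉ M (m + 1))
    (hs : ∀ m, genFun (M (m + 1)) = rescale X (genFun (M (m + 1))) +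
      genFun {s | (∀ x ∈ s, x ≤ 2) ∧ 1 ∈ s} * rescale X (rescale X (genFun (M m)))) (m : ℕ) :
    genFun (M m) = genFun (durfeeSet m) := by
  induction m with
  | zero => rw [h0, genFun_durfeeSet_zero]
  | succ m ih =>
    rw [← sub_eq_zero]
    refine eq_zero_of_eq_rescale ?_ ?_
    · have h1 := hs m
      have h2 := genFun_durfeeSet_succ m
      rw [ih] at h1
      rw [map_sub]
      linear_combination h1 - h2
    · rw [map_sub, coeff_zero_genFun (hM m), coeff_zero_genFun (zero_notMem_durfeeSet m), sub_zero]

/-! ### The 2-measure and its recursion -/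

/-- The elements of `u` are at distance at least two from each other. -/
def Separated (u : Finset ℕ) : Prop := ∀ a ∈ u, ∀ b ∈ u, a < b → a + 2 ≤ b

open Classical in
/-- The maximal size of a separated subset. -/
noncomputable def maxSeparated (A : Finset ℕ) : ℕ := (A.powerset.filter Separated).sup card

lemma card_le_maxSeparated {A u : Finset ℕ} (h : u ⊆ A) (hu : Separated u) :
    #u ≤ maxSeparated A := by
  classical
  exact le_sup (f := card) (by simp [h, hu])

lemma exists_separated (A : Finset ℕ) : ∃ u ⊆ A, Separated u ∧ #u = maxSeparated A := by
  classical
  obtain ⟨u, hu, h⟩ := exists_mem_eq_sup (A.powerset.filter Separated)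
    ⟨∅, by simp [Separated]⟩ card
  rw [mem_filter, mem_powerset] at hu
  exact ⟨u, hu.1, hu.2, h.symm⟩

lemma maxSeparated_eq_zero {A : Finset ℕ} : maxSeparated A = 0 ↔ A = ∅ := by
  constructor
  · intro h
    by_contra hne
    obtain ⟨a, ha⟩ := nonempty_iff_ne_empty.2 hne
    have := card_le_maxSeparated (u := {a}) (singleton_subset_iff.2 ha) (by simp [Separated])
    simp [h] at this
  · rintro rfl
    obtain ⟨u, hu, -, h⟩ := exists_separated ∅
    rw [← h, subset_empty.1 hu, card_empty]

lemma maxSeparated_image_succ (A : Finset ℕ) : maxSeparated (A.image (· + 1)) = maxSeparated A := by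
  have hinj : Function.Injective fun x : ℕ => x + 1 := add_left_injective 1
  apply le_antisymm
  · obtain ⟨u, hu, hs, h⟩ := exists_separated (A.image (· + 1))
    obtain ⟨v, hv, rfl⟩ := subset_image_iff.1 hu
    rw [← h, card_image_of_injective _ hinj]
    refine card_le_maxSeparated hv fun a ha b hb hab => ?_
    have := hs _ (mem_image_of_mem _ ha) _ (mem_image_of_mem _ hb) (by omega)
    omega
  · obtain ⟨u, hu, hs, h⟩ := exists_separated A
    rw [← h, ← card_image_of_injective _ hinj]
    refine card_le_maxSeparated (image_subset_image hu) ?_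
    simp only [Separated, mem_image]
    rintro _ ⟨a, ha, rfl⟩ _ ⟨b, hb, rfl⟩ hab
    have := hs a ha b hb (by omega)
    omega

/-- A separated set contains at most one of 1 and 2, while 1 can be added to any separated subset of
`B`. -/
lemma maxSeparated_union {A B : Finset ℕ} (h1 : 1 ∈ A) (hA : ∀ x ∈ A, x = 1 ∨ x = 2)
    (hB : ∀ x ∈ B, 3 ≤ x) : maxSeparated (A ∪ B) = maxSeparated B + 1 := by
  apply le_antisymm
  · obtain ⟨u, hu, hs, h⟩ := exists_separated (A ∪ B)
    rw [← h, ← card_filter_add_card_filter_not (3 ≤ ·)]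
    refine add_le_add (card_le_maxSeparated ?_ fun a ha b hb => ?_) (card_le_one.2 ?_)
    · intro x hx
      rw [mem_filter] at hx
      rcases mem_union.1 (hu hx.1) with h | h
      · have := hA x h
        omega
      · exact h
    · exact hs a (mem_filter.1 ha).1 b (mem_filter.1 hb).1
    · intro a ha b hb
      rw [mem_filter] at ha hb
      have key : ∀ x ∈ u, ¬ 3 ≤ x → x = 1 ∨ x = 2 := by
        intro x hx hx3
        rcases mem_union.1 (hu hx) with h | h
        · exact hA x h
        · exact absurd (hB x h) hx3
      have := key a ha.1 ha.2
      have := key b hb.1 hb.2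
      have := hs a ha.1 b hb.1
      have := hs b hb.1 a ha.1
      omega
  · obtain ⟨u, hu, hs, h⟩ := exists_separated B
    have hn : 1 ∉ u := fun hc => by
      have := hB 1 (hu hc)
      omega
    rw [← h, ← card_insert_of_notMem hn]
    refine card_le_maxSeparated (insert_subset (mem_union_left _ h1)
      (hu.trans subset_union_right)) ?_
    intro a ha b hb hab
    rw [mem_insert] at ha hb
    rcases ha with rfl | ha
    · rcases hb with rfl | hb
      · omega
      · exact hB b (hu hb)
    · rcases hb with rfl | hb
      · have := hB a (hu ha)
        omega
      · exact hs a ha b hb hab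

/-- The multisets whose largest separated subset has `m` elements. -/
def measureSet (m : ℕ) : Set (Multiset ℕ) := {s | maxSeparated s.toFinset = m}

lemma map_succ_mem_measureSet {m : ℕ} {s : Multiset ℕ} :
    s.map (· + 1) ∈ measureSet m ↔ s ∈ measureSet m := by
  simp only [measureSet, Set.mem_ofPred_eq, Multiset.toFinset_map, maxSeparated_image_succ]

lemma genFun_measureSet_zero : genFun (measureSet 0) = 1 := by
  rw [genFun_congr (T := {0}), genFun_singleton] <;> simp [measureSet, maxSeparated_eq_zero]

lemma zero_notMem_measureSet (m : ℕ) : 0 ∉ measureSet (m + 1) := by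
  simp [measureSet, maxSeparated_eq_zero.2]

lemma genFun_measureSet_one_mem (m : ℕ) :
    genFun {s | s ∈ measureSet (m + 1) ∧ 1 ∈ s} =
      genFun {s | (∀ x ∈ s, x ≤ 2) ∧ 1 ∈ s} * genFun {s | s ∈ measureSet m ∧ ∀ x ∈ s, 3 ≤ x} := by
  refine genFun_mul (fun u h0 => ⟨?_, ?_⟩) ?_
  · rintro ⟨hm, h1⟩
    have hu := Multiset.filter_add_not (· ≤ 2) u
    refine ⟨u.filter (· ≤ 2), ⟨fun x hx => (Multiset.mem_filter.1 hx).2, by simp [h1]⟩,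
      u.filter (¬ · ≤ 2), ⟨?_, fun x hx => not_le.1 (Multiset.mem_filter.1 hx).2⟩, hu⟩
    rw [measureSet, Set.mem_ofPred_eq] at hm ⊢
    rw [← hu, Multiset.toFinset_add, maxSeparated_union] at hm
    · omega
    · simp [h1]
    · intro x hx
      rw [Multiset.mem_toFinset, Multiset.mem_filter] at hx
      have : x ≠ 0 := fun h => h0 (h ▸ hx.1)
      omega
    · intro x hx
      rw [Multiset.mem_toFinset, Multiset.mem_filter] at hx
      omega
  · rintro ⟨s, ⟨hs, h1⟩, t, ⟨ht, ht3⟩, rfl⟩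
    refine ⟨?_, Multiset.mem_add.2 (Or.inl h1)⟩
    rw [measureSet, Set.mem_ofPred_eq] at ht ⊢
    rw [Multiset.toFinset_add, maxSeparated_union, ht]
    · simpa using h1
    · intro x hx
      rw [Multiset.mem_toFinset] at hx
      have : x ≠ 0 := fun h => h0 (h ▸ Multiset.mem_add.2 (Or.inl hx))
      have := hs x hx
      omega
    · simpa using ht3
  · have key : ∀ s t : Multiset ℕ, (∀ x ∈ s, x ≤ 2) → (∀ x ∈ t, 3 ≤ x) →
        (s + t).filter (· ≤ 2) = s := by
      intro s t hs ht
      rw [Multiset.filter_add, Multiset.filter_eq_self.2 hs,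
        Multiset.filter_eq_nil (s := t) |>.2 fun x hx => by have := ht x hx; omega, add_zero]
    rintro s ⟨hs, -⟩ t ⟨-, ht⟩ s' ⟨hs', -⟩ t' ⟨-, ht'⟩ h
    rw [← key s t hs ht, h, key s' t' hs' ht']

lemma genFun_measureSet_succ (m : ℕ) :
    genFun (measureSet (m + 1)) = rescale X (genFun (measureSet (m + 1))) +
      genFun {s | (∀ x ∈ s, x ≤ 2) ∧ 1 ∈ s} * rescale X (rescale X (genFun (measureSet m))) := by
  have h1 : genFun {s | s ∈ measureSet (m + 1) ∧ 1 ∉ s} =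
      rescale X (genFun (measureSet (m + 1))) := by
    refine genFun_shift (fun s hs => ?_) fun t ht => ht.2
    rw [Set.mem_ofPred_eq, map_succ_mem_measureSet]
    simp [hs]
  have h2 : genFun {s | s ∈ measureSet m ∧ ∀ x ∈ s, 2 ≤ x} =
      rescale X (genFun (measureSet m)) := by
    refine genFun_shift (fun s hs => ?_) fun t ht h => by
      have := ht.2 1 h
      omega
    rw [Set.mem_ofPred_eq, map_succ_mem_measureSet, and_iff_left]
    intro x hx
    obtain ⟨y, hy, rfl⟩ := Multiset.mem_map.1 hx
    have : y ≠ 0 := fun h => hs (h ▸ hy)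
    omega
  have h3 : genFun {s | s ∈ measureSet m ∧ ∀ x ∈ s, 3 ≤ x} =
      rescale X (genFun {s | s ∈ measureSet m ∧ ∀ x ∈ s, 2 ≤ x}) := by
    refine genFun_shift (fun s hs => ?_) fun t ht h => by
      have := ht.2 1 h
      omega
    rw [Set.mem_ofPred_eq, map_succ_mem_measureSet]
    simp
  rw [← h1, ← h2, ← h3, ← genFun_measureSet_one_mem]
  exact genFun_disjUnion (fun s _ => by simp only [Set.mem_ofPred_eq]; tauto)
    fun s hs ht => hs.2 ht.2

/-! ### Matching both statistics with the multiset families -/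

/-- Gaps of at least 2 force distinct terms, so multiplicities are irrelevant and chains correspond
to separated sets. -/
lemma kMeasure_eq_maxSeparated {n : ℕ} (p : n.Partition) :
    p.kMeasure 2 = maxSeparated p.parts.toFinset := by
  have hL : p.partsList.Pairwise (· ≥ ·) := p.parts.pairwise_sort _
  have hmem (x : ℕ) : x ∈ p.partsList ↔ x ∈ p.parts := Multiset.mem_sort _
  apply le_antisymm
  · refine Finset.sup_le fun s hs => ?_
    rw [mem_filter, List.mem_toFinset, List.mem_sublists] at hs
    have : IsTrans ℕ fun a b => b + 2 ≤ a := ⟨fun a b c _ _ => by omega⟩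
    have hp : s.Pairwise fun a b => b + 2 ≤ a := List.isChain_iff_pairwise.1 hs.2
    have hnd : s.Nodup := hp.imp fun h => by omega
    rw [← List.toFinset_card_of_nodup hnd]
    refine card_le_maxSeparated ?_ ?_
    · intro x hx
      rw [Multiset.mem_toFinset, ← hmem]
      exact hs.1.subset (List.mem_toFinset.1 hx)
    · intro a ha b hb hab
      rw [List.mem_toFinset] at ha hb
      exact List.Pairwise.forall_of_forall_of_flip (R := fun a b => a < b → a + 2 ≤ b)
        (fun x _ h => absurd h (lt_irrefl x)) (hp.imp fun h h' => by omega)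
        (hp.imp (S := flip fun a b => a < b → a + 2 ≤ b) fun h _ => h) ha hb hab
  · obtain ⟨u, hu, hs, h⟩ := exists_separated p.parts.toFinset
    rw [← h, ← length_sort (s := u) (· ≥ ·)]
    refine le_sup (f := List.length) ?_
    rw [mem_filter, List.mem_toFinset, List.mem_sublists]
    have hsort : (u.sort (· ≥ ·)).Pairwise (· ≥ ·) := u.pairwise_sort _
    have hnd : (u.sort (· ≥ ·)).Nodup := u.sort_nodup _
    constructor
    · refine List.sublist_of_subperm_of_pairwise ?_ hsort hL
      refine hnd.subperm fun x hx => ?_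
      rw [hmem, ← Multiset.mem_toFinset]
      exact hu ((mem_sort _).1 hx)
    · refine (List.Pairwise.imp_of_mem ?_ (hsort.and hnd)).isChain
      intro a b ha hb hab
      exact hs b ((mem_sort _).1 hb) a ((mem_sort _).1 ha) (lt_of_le_of_ne hab.1 hab.2.symm)

lemma kMeasure_eq_iff {n : ℕ} (p : n.Partition) (m : ℕ) :
    p.kMeasure 2 = m ↔ p.parts ∈ measureSet m := by
  rw [kMeasure_eq_maxSeparated, measureSet, Set.mem_ofPred_eq]

/-- If m < m', then `u` would have at least m' elements above m by one splitting, but at most m by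
the other. -/
lemma durfeeSet_unique {u : Multiset ℕ} {m m' : ℕ} (h : u ∈ durfeeSet m) (h' : u ∈ durfeeSet m') :
    m = m' := by
  have key : ∀ {m m' : ℕ}, u ∈ durfeeSet m → u ∈ durfeeSet m' → m' ≤ m := by
    rintro m m' ⟨s, ⟨hs, -⟩, t, ht, rfl⟩ ⟨s', ⟨hs', hs''⟩, t', -, h⟩
    by_contra! hlt
    have h1 : ((s + t).filter (m < ·)).card ≤ m := by
      rw [filter_lt_add ht, ← hs]
      exact Multiset.card_le_card (Multiset.filter_le _ s)
    rw [← h, Multiset.filter_add, Multiset.card_add,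
      Multiset.filter_eq_self.2 fun x hx => hlt.trans_le (hs'' x hx)] at h1
    omega
  exact le_antisymm (key h' h) (key h h')

lemma square_subset_ferrers {n : ℕ} (p : n.Partition) (d : ℕ) :
    Finset.range d ×ˢ Finset.range d ⊆ p.ferrers.cells ↔
      ∀ i < d, ∃ h : i < p.partsList.length, d ≤ p.partsList[i] := by
  have hmem (c : ℕ × ℕ) : c ∈ p.ferrers.cells ↔
      ∃ h : c.1 < p.partsList.length, c.2 < p.partsList[c.1] :=
    (YoungDiagram.mem_cells _).trans YoungDiagram.mem_ofRowLens
  constructor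
  · intro h i hi
    obtain ⟨h1, h2⟩ := (hmem _).1 (h (mem_product.2
      (⟨mem_range.2 hi, mem_range.2 (Nat.sub_one_lt (by omega : d ≠ 0))⟩ :
        (i, d - 1).1 ∈ range d ∧ (i, d - 1).2 ∈ range d)))
    exact ⟨h1, by simp only at h2; omega⟩
  · intro h c hc
    rw [mem_product, mem_range, mem_range] at hc
    obtain ⟨h1, h2⟩ := h _ hc.1
    exact (hmem c).2 ⟨h1, hc.2.trans_le h2⟩

lemma parts_mem_durfeeSet {n : ℕ} (p : n.Partition) : p.parts ∈ durfeeSet p.durfee := by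
  have hL : p.partsList.SortedGE := (p.parts.pairwise_sort (· ≥ ·)).sortedGE
  have hcoe : (p.partsList : Multiset ℕ) = p.parts := Multiset.sort_eq _ _
  obtain ⟨d, hd⟩ : ∃ d, d = p.durfee := ⟨_, rfl⟩
  have hsq : ∀ i < d, ∃ h : i < p.partsList.length, d ≤ p.partsList[i] := by
    rw [← square_subset_ferrers, hd, Nat.Partition.durfee]
    exact Nat.findGreatest_spec
      (P := fun d => Finset.range d ×ˢ Finset.range d ⊆ p.ferrers.cells) (Nat.zero_le n) (by simp)
  have hlen : d ≤ p.partsList.length := by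
    by_contra! hlt
    exact lt_irrefl _ (hsq _ hlt).1
  have hnsq : ¬ ∀ i < d + 1, ∃ h : i < p.partsList.length, d + 1 ≤ p.partsList[i] := by
    intro h
    -- A larger square would still lie within the search bound, since the largest part is at most
    -- `n`.
    have hle : d + 1 ≤ n := by
      obtain ⟨h1, h2⟩ := h 0 (by omega)
      refine h2.trans (p.le_of_mem_parts ?_)
      rw [← hcoe]
      exact List.getElem_mem h1
    have := Nat.le_findGreatest
      (P := fun d => Finset.range d ×ˢ Finset.range d ⊆ p.ferrers.cells) hle
      ((square_subset_ferrers p (d + 1)).2 h)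
    change d + 1 ≤ p.durfee at this
    omega
  rw [← hd]
  refine ⟨p.partsList.take d, ⟨?_, ?_⟩, p.partsList.drop d, ?_, ?_⟩
  · simpa using hlen
  · intro x hx
    obtain ⟨i, hi, rfl⟩ := List.mem_take_iff_getElem.1 (Multiset.mem_coe.1 hx)
    exact (hsq i (by omega)).2
  · intro x hx
    obtain ⟨i, hi, rfl⟩ := List.mem_drop_iff_getElem.1 (Multiset.mem_coe.1 hx)
    by_contra! hlt
    -- A part above d at index d or later would make the first d + 1 parts all at least d + 1.
    refine hnsq fun j hj => ⟨by omega, ?_⟩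
    exact (Nat.succ_le_of_lt hlt).trans (hL.getElem_ge_getElem_of_le (by omega))
  · rw [Multiset.coe_add, List.take_append_drop, hcoe]

lemma durfee_eq_iff {n : ℕ} (p : n.Partition) (m : ℕ) :
    p.durfee = m ↔ p.parts ∈ durfeeSet m :=
  ⟨fun h => h ▸ parts_mem_durfeeSet p, fun h => durfeeSet_unique (parts_mem_durfeeSet p) h⟩

end PartitionSeries

theorem corollary1p4 (n l m : ℕ) :
    (Finset.univ.filter fun p : n.Partition => p.parts.card = l ∧ p.kMeasure 2 = m).card =
      (Finset.univ.filter fun p : n.Partition => p.parts.card = l ∧ p.durfee = m).card := by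
  classical
  have h := congrArg (fun f => coeff n (coeff l f))
    (PartitionSeries.genFun_eq_durfeeSet PartitionSeries.genFun_measureSet_zero
      PartitionSeries.zero_notMem_measureSet PartitionSeries.genFun_measureSet_succ m)
  simp only [PartitionSeries.coeff_coeff_genFun, Nat.cast_inj, ← PartitionSeries.card_slice] at h
  simp only [PartitionSeries.durfee_eq_iff, PartitionSeries.kMeasure_eq_iff]
  exact h
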